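/- Let $k$ be a field of prime characteristic $p$, let $r_0,r_1,r_2\in k[t]$ be polynomials with $r_0r_2\neq 0$ and $2\deg r_1>\deg r_0+\deg r_2$, and let $$R=\frac{k[t,u,v,x,y]}{(r_0u^2x^2+r_1uxvy+r_2v^2y^2)},\qquad I=(u,v,x,y)\subseteq R.$$ For an ideal $J$ of $R$ and $q=p^e$ with $e\ge 0$, let $J^{[q]}$ denote the ideal generated by all $q$-th powers of elements of $J$ (equivalently, by the $q$-th powers of any set of generators of $J$), and write $J^{c[q]}=(J^c)^{[q]}$. Then the Frobenius powers of $I$ have linear growth of primary decompositions: there is a constant $c\in\mathbb N$ such that for every $q=p^e$, $e\ge 0$, there are finitely many primary ideals $Q_1,\dots,Q_s$ of $R$ (with $s$ depending on $q$) such that $$I^{[q]}=Q_1\cap Q_2\cap\cdots\cap Q_s\qquad\text{and}\qquad (\sqrt{Q_i})^{c[q]}\subseteq Q_i\quad\text{for all } i=1,\dots,s.$$ In particular, this holds for $r_0=r_2=1$, $r_1=t$, that is, for the ideal $(u,v,x,y)$ of $k[t,u,v,x,y]/(u^2x^2+tuxvy+v^2y^2)$. -/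

import Mathlib

open Polynomial

noncomputable section

/-- The `q`-th Frobenius power `I^[q]` of an ideal `I`, for `q` a power of the characteristic:
the ideal generated by the `q`-th powers of the elements of `I`. -/
def Ideal.frobeniusPower {R : Type*} [CommRing R] (q : ℕ) (I : Ideal R) : Ideal R :=
  Ideal.span ((fun a : R => a ^ q) '' (I : Set R))

/-- In characteristic `p`, the Frobenius power `I^[q]` is generated by the `q`-th powers of any
set of generators of `I`. -/
theorem Ideal.frobeniusPower_span {R : Type*} [CommRing R] (p : ℕ) [Fact p.Prime] [CharP R p]
    (e : ℕ) (S : Set R) :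
    (Ideal.span S).frobeniusPower (p ^ e) = Ideal.span ((fun a : R => a ^ p ^ e) '' S) := by
  have h : (fun a : R => a ^ p ^ e) = iterateFrobenius R p e := by
    ext a; rw [iterateFrobenius_def]
  rw [Ideal.frobeniusPower, h, ← Ideal.map_span, ← Ideal.map_span, Ideal.span_eq]

/-- The Frobenius powers of `I`, in a ring of prime characteristic `p`, have linear growth of
primary decompositions: there is a constant `c` such that for every `q = p ^ e` the ideal `I^[q]`
is a finite intersection of primary ideals `Q` with `(√Q)^{c[q]} = ((√Q)^c)^[q] ⊆ Q`. -/
def HasLinearGrowthOfPrimaryDecompositions {R : Type*} [CommRing R] (p : ℕ) (I : Ideal R) :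
    Prop :=
  ∃ c : ℕ, ∀ e : ℕ, ∃ D : Finset (Ideal R),
    (∀ Q ∈ D, Q.IsPrimary) ∧
    D.inf id = I.frobeniusPower (p ^ e) ∧
    ∀ Q ∈ D, (Q.radical ^ c).frobeniusPower (p ^ e) ≤ Q

namespace SSHypersurface

/-- The polynomial ring `k[t,u,v,x,y]`, presented as `k[t][u,v,x,y]`; the variables `u, v, x, y`
are numbered `0, 1, 2, 3`. -/
abbrev PolyRing (k : Type*) [Field k] : Type _ := MvPolynomial (Fin 4) k[X]

/-- The polynomial `r₀u²x² + r₁uxvy + r₂v²y²`, where `r₀, r₁, r₂ ∈ k[t]`. -/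
def equation {k : Type*} [Field k] (r₀ r₁ r₂ : k[X]) : PolyRing k :=
  let u : PolyRing k := MvPolynomial.X 0
  let v : PolyRing k := MvPolynomial.X 1
  let x : PolyRing k := MvPolynomial.X 2
  let y : PolyRing k := MvPolynomial.X 3
  MvPolynomial.C r₀ * u ^ 2 * x ^ 2 + MvPolynomial.C r₁ * u * x * v * y +
    MvPolynomial.C r₂ * v ^ 2 * y ^ 2

/-- The coordinate ring `k[t,u,v,x,y]/(r₀u²x² + r₁uxvy + r₂v²y²)` of the hypersurface. -/
abbrev CoordRing {k : Type*} [Field k] (r₀ r₁ r₂ : k[X]) : Type _ :=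
  PolyRing k ⧸ Ideal.span {equation r₀ r₁ r₂}

/-- The ideal `(u, v, x, y)` of the coordinate ring. -/
def idealUVXY {k : Type*} [Field k] (r₀ r₁ r₂ : k[X]) : Ideal (CoordRing r₀ r₁ r₂) :=
  Ideal.span (Set.range fun i : Fin 4 =>
    (Ideal.Quotient.mk (Ideal.span {equation r₀ r₁ r₂}) (MvPolynomial.X i) :
      CoordRing r₀ r₁ r₂))

end SSHypersurface

end

/-!
Put `A = k[t]` and let `ε : R → A` be the retraction with kernel `I`, which kills `u, v, x, y`. As
`z ^ q ≡ ε(z) ^ q` modulo `I^[q]`, the ideal `T` of the elements that are `A`-torsion modulo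
`I^[q]` is `I`-primary. If a squarefree `s ∈ A` satisfies `s ^ (c q) T ⊆ I^[q]`, then
`I^[q] = T ∩ (I^[q] + (s ^ (c q)))`, and by the Chinese remainder theorem the second ideal is the
intersection of the ideals `(ε⁻¹(τ ^ c))^[q]` for the primes `τ ∣ s`; these are primary because
their radicals are maximal.

To find `s`, note that `r₀u²x² + r₁uxvy + r₂v²y²` is homogeneous for a `ℤ³`-grading over `A` in
which every graded piece of `A[u, v, x, y] / (u ^ q, v ^ q, x ^ q, y ^ q)` is free of rank at most
`q`. The torsion of such a piece modulo the equation is killed by a nonzero determinant of size at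
most `q` whose entries have degree at most some `D`, hence by a polynomial of degree at most `D q`,
which divides `s ^ (D q)` as soon as `s` is a multiple of its radical.
-/

open nonZeroDivisors

section FrobeniusPower

variable {R : Type*} [CommRing R] {I J : Ideal R} {q : ℕ}

theorem pow_mem_frobeniusPower {a : R} (ha : a ∈ I) : a ^ q ∈ I.frobeniusPower q :=
  Ideal.subset_span ⟨a, ha, rfl⟩

theorem frobeniusPower_mono (h : I ≤ J) : I.frobeniusPower q ≤ J.frobeniusPower q :=
  Ideal.span_mono (Set.image_mono h)

theorem frobeniusPower_le_self (hq : q ≠ 0) : I.frobeniusPower q ≤ I := by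
  rw [Ideal.frobeniusPower, Ideal.span_le]
  rintro _ ⟨a, ha, rfl⟩
  exact Ideal.pow_mem_of_mem I ha q hq.pos

theorem radical_frobeniusPower (hq : q ≠ 0) : (I.frobeniusPower q).radical = I.radical :=
  le_antisymm (Ideal.radical_mono (frobeniusPower_le_self hq)) <|
    Ideal.radical_le_radical_iff.2 fun _ ha => ⟨q, pow_mem_frobeniusPower ha⟩

variable (p : ℕ) [Fact p.Prime] [CharP R p] (e : ℕ)

theorem frobeniusPower_eq_map (I : Ideal R) :
    I.frobeniusPower (p ^ e) = I.map (iterateFrobenius R p e) :=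
  rfl

theorem frobeniusPower_sup (I J : Ideal R) :
    (I ⊔ J).frobeniusPower (p ^ e) = I.frobeniusPower (p ^ e) ⊔ J.frobeniusPower (p ^ e) := by
  simp only [frobeniusPower_eq_map, Ideal.map_sup]

theorem frobeniusPower_prod {ι : Type*} (s : Finset ι) (I : ι → Ideal R) :
    (∏ i ∈ s, I i).frobeniusPower (p ^ e) = ∏ i ∈ s, (I i).frobeniusPower (p ^ e) :=
  map_prod (Ideal.mapHom (iterateFrobenius R p e)) I s

theorem frobeniusPower_span_singleton (a : R) :
    (Ideal.span {a}).frobeniusPower (p ^ e) = Ideal.span {a ^ p ^ e} := by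
  rw [Ideal.frobeniusPower_span, Set.image_singleton]

theorem isCoprime_frobeniusPower (h : IsCoprime I J) :
    IsCoprime (I.frobeniusPower (p ^ e)) (J.frobeniusPower (p ^ e)) :=
  h.map (Ideal.mapHom (iterateFrobenius R p e))

end FrobeniusPower

section TorsionClosure

variable (A : Type*) {R : Type*} [CommRing A] [CommRing R] [Algebra A R] {J : Ideal R}

/-- The elements of an `A`-algebra `R` that are `A`-torsion modulo the ideal `J`, i.e. the
contraction to `R` of the extension of `J` to the localization of `R` at the regular elements
of `A`. -/
def torsionClosure (J : Ideal R) : Ideal R where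
  carrier := {z | ∃ g ∈ A⁰, g • z ∈ J}
  zero_mem' := ⟨1, one_mem _, by simp⟩
  add_mem' := by
    rintro a b ⟨g, hg, ha⟩ ⟨h, hh, hb⟩
    refine ⟨g * h, mul_mem hg hh, ?_⟩
    rw [smul_add, mul_smul, mul_smul, smul_comm]
    exact J.add_mem (J.smul_of_tower_mem h ha) (J.smul_of_tower_mem g hb)
  smul_mem' := by
    rintro r z ⟨g, hg, hz⟩
    exact ⟨g, hg, by rw [smul_comm]; exact J.smul_mem r hz⟩

variable {A}

theorem le_torsionClosure : J ≤ torsionClosure A J :=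
  fun z hz => ⟨1, one_mem _, by rwa [one_smul]⟩

theorem torsionClosure_mono {I J : Ideal R} (h : I ≤ J) : torsionClosure A I ≤ torsionClosure A J :=
  fun _ ⟨g, hg, hz⟩ => ⟨g, hg, h hz⟩

theorem smul_mem_torsionClosure_iff {g : A} (hg : g ∈ A⁰) {z : R} :
    g • z ∈ torsionClosure A J ↔ z ∈ torsionClosure A J := by
  refine ⟨?_, fun hz => Submodule.smul_of_tower_mem _ g hz⟩
  rintro ⟨h, hh, hz⟩
  exact ⟨h * g, mul_mem hh hg, by rwa [mul_smul]⟩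

end TorsionClosure

section Retraction

theorem prod_comap_le {ι A R : Type*} [CommRing A] [CommRing R] (φ : R →+* A) (s : Finset ι)
    (𝔞 : ι → Ideal A) :
    ∏ i ∈ s, (𝔞 i).comap φ ≤ (∏ i ∈ s, 𝔞 i).comap φ := by
  classical
  induction s using Finset.induction_on with
  | empty => simp
  | insert i s hi ih =>
    rw [Finset.prod_insert hi, Finset.prod_insert hi]
    exact (Ideal.mul_mono_right ih).trans (Ideal.le_comap_mul φ)

variable {A R : Type*} [CommRing A] [CommRing R] [Algebra A R] (ε : R →ₐ[A] A)

theorem surjective_of_retraction : Function.Surjective ε :=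
  fun a => ⟨algebraMap A R a, ε.commutes a⟩

theorem comap_span_singleton_of_retraction (a : A) :
    (Ideal.span {a}).comap ε = RingHom.ker ε ⊔ Ideal.span {algebraMap A R a} := by
  have h := Ideal.comap_map_of_surjective' ε (surjective_of_retraction ε)
    (Ideal.span {algebraMap A R a})
  rw [Ideal.map_span, Set.image_singleton, AlgHom.commutes] at h
  rw [sup_comm]; exact h

theorem isCoprime_comap_of_retraction {𝔞 𝔟 : Ideal A} (h : IsCoprime 𝔞 𝔟) :
    IsCoprime (𝔞.comap ε) (𝔟.comap ε) := by
  obtain ⟨a, ha, b, hb, hab⟩ := Ideal.isCoprime_iff_exists.1 h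
  refine Ideal.isCoprime_iff_exists.2 ⟨algebraMap A R a, ?_, algebraMap A R b, ?_, ?_⟩
  · simpa using ha
  · simpa using hb
  · rw [← map_add, hab, map_one]

theorem radical_frobeniusPower_comap_pow {𝔭 : Ideal A} [𝔭.IsPrime] {c q : ℕ} (hc : c ≠ 0)
    (hq : q ≠ 0) : (((𝔭 ^ c).comap ε).frobeniusPower q).radical = 𝔭.comap ε := by
  rw [radical_frobeniusPower hq, ← Ideal.comap_radical, Ideal.radical_pow 𝔭 hc,
    Ideal.IsPrime.radical inferInstance]

theorem isPrimary_frobeniusPower_comap_pow {𝔪 : Ideal A} [𝔪.IsMaximal] {c q : ℕ} (hc : c ≠ 0)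
    (hq : q ≠ 0) : (((𝔪 ^ c).comap ε).frobeniusPower q).IsPrimary := by
  refine Ideal.isPrimary_of_isMaximal_radical ?_
  rw [radical_frobeniusPower_comap_pow ε hc hq]
  exact Ideal.comap_isMaximal_of_surjective ε (surjective_of_retraction ε)

variable (p : ℕ) [Fact p.Prime] [CharP R p] (e : ℕ)

theorem pow_sub_algebraMap_mem_frobeniusPower_ker (z : R) :
    z ^ p ^ e - algebraMap A R (ε z) ^ p ^ e ∈ (RingHom.ker ε).frobeniusPower (p ^ e) := by
  rw [← sub_pow_char_pow]
  exact pow_mem_frobeniusPower (by simp [RingHom.mem_ker])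

theorem iInf_frobeniusPower_comap_le {ι : Type*} {s : Finset ι} {𝔞 : ι → Ideal A}
    (h : (s : Set ι).Pairwise (Function.onFun IsCoprime 𝔞)) :
    ⨅ i ∈ s, ((𝔞 i).comap ε).frobeniusPower (p ^ e) ≤
      ((∏ i ∈ s, 𝔞 i).comap ε).frobeniusPower (p ^ e) := by
  rw [← Ideal.prod_eq_iInf_of_pairwise_isCoprime fun i hi j hj hij =>
    isCoprime_frobeniusPower p e (isCoprime_comap_of_retraction ε (h hi hj hij)),
    ← frobeniusPower_prod]
  exact frobeniusPower_mono (prod_comap_le ε.toRingHom s 𝔞)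

theorem torsionClosure_inf_sup_span_singleton_le {J : Ideal R} {a : A} (ha : a ∈ A⁰)
    (h : ∀ z ∈ torsionClosure A J, a • z ∈ J) :
    torsionClosure A J ⊓ (J ⊔ Ideal.span {algebraMap A R a}) ≤ J := by
  rintro z ⟨hz, hza⟩
  obtain ⟨j, hj, b, hb, rfl⟩ := Submodule.mem_sup.1 hza
  obtain ⟨r, rfl⟩ := Ideal.mem_span_singleton.1 hb
  rw [← Algebra.smul_def] at hz ⊢
  have har : a • r ∈ torsionClosure A J :=
    (Submodule.add_mem_iff_right _ (le_torsionClosure hj)).1 hz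
  exact J.add_mem hj (h r ((smul_mem_torsionClosure_iff ha).1 har))

variable [IsDomain A]

theorem torsionClosure_ker : torsionClosure A (RingHom.ker ε) = RingHom.ker ε := by
  refine le_antisymm ?_ le_torsionClosure
  rintro z ⟨g, hg, hz⟩
  rw [RingHom.mem_ker, map_smul, smul_eq_mul, mul_eq_zero] at hz
  exact hz.resolve_left (nonZeroDivisors.ne_zero hg)

theorem radical_torsionClosure_frobeniusPower_ker {q : ℕ} (hq : q ≠ 0) :
    (torsionClosure A ((RingHom.ker ε).frobeniusPower q)).radical = RingHom.ker ε := by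
  have hprime : (RingHom.ker ε).IsPrime := RingHom.ker_isPrime ε
  refine le_antisymm (hprime.radical_le_iff.2 ?_) fun z hz =>
    ⟨q, le_torsionClosure (pow_mem_frobeniusPower hz)⟩
  exact (torsionClosure_mono (frobeniusPower_le_self hq)).trans_eq (torsionClosure_ker ε)

theorem isPrimary_torsionClosure_frobeniusPower_ker :
    (torsionClosure A ((RingHom.ker ε).frobeniusPower (p ^ e))).IsPrimary := by
  set J := (RingHom.ker ε).frobeniusPower (p ^ e)
  have hrad : (torsionClosure A J).radical = RingHom.ker ε :=
    radical_torsionClosure_frobeniusPower_ker ε (expChar_pow_pos R p e).ne'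
  rw [Ideal.isPrimary_iff]
  refine ⟨fun htop => RingHom.ker_ne_top ε (by rw [← hrad, htop, Ideal.radical_top]), ?_⟩
  intro x y hxy
  rw [hrad, RingHom.mem_ker, or_iff_not_imp_right]
  intro hy
  -- Modulo `J`, multiplication by `y ^ q` is multiplication by the regular element `ε y ^ q`.
  have hεy : ε y ^ p ^ e ∈ A⁰ := mem_nonZeroDivisors_of_ne_zero (pow_ne_zero _ hy)
  rw [← smul_mem_torsionClosure_iff hεy]
  have h₁ : x * y ^ p ^ e ∈ torsionClosure A J := by
    rw [← Nat.sub_add_cancel (expChar_pow_pos R p e), pow_succ', ← mul_assoc]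
    exact Ideal.mul_mem_right _ _ hxy
  have h₂ := Ideal.mul_mem_left _ x
    (le_torsionClosure (A := A) (pow_sub_algebraMap_mem_frobeniusPower_ker ε p e y))
  have := sub_mem h₁ h₂
  rwa [← mul_sub, sub_sub_cancel, ← map_pow, mul_comm, ← Algebra.smul_def] at this

end Retraction

section Criterion

variable {A R : Type*} [CommRing A] [CommRing R] [Algebra A R] (ε : R →ₐ[A] A)
  (p : ℕ) [Fact p.Prime] [CharP R p]

theorem torsionClosure_inf_iInf_frobeniusPower_comap (e : ℕ) {T : Finset A} {c : ℕ}
    (hT : (T : Set A).Pairwise IsCoprime) (hT₀ : ∏ τ ∈ T, τ ∈ A⁰)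
    (h : ∀ z ∈ torsionClosure A ((RingHom.ker ε).frobeniusPower (p ^ e)),
      (∏ τ ∈ T, τ) ^ (c * p ^ e) • z ∈ (RingHom.ker ε).frobeniusPower (p ^ e)) :
    torsionClosure A ((RingHom.ker ε).frobeniusPower (p ^ e)) ⊓
        ⨅ τ ∈ T, ((Ideal.span {τ} ^ c).comap ε).frobeniusPower (p ^ e) =
      (RingHom.ker ε).frobeniusPower (p ^ e) := by
  refine le_antisymm ?_ (le_inf le_torsionClosure (le_iInf₂ fun τ _ => frobeniusPower_mono ?_))
  · have hprod : ∏ τ ∈ T, Ideal.span {τ} ^ c = Ideal.span {(∏ τ ∈ T, τ) ^ c} := by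
      rw [Finset.prod_pow, Ideal.prod_span_singleton, Ideal.span_singleton_pow]
    refine (inf_le_inf_left _ ((iInf_frobeniusPower_comap_le ε p e ?_).trans_eq ?_)).trans
      (torsionClosure_inf_sup_span_singleton_le (pow_mem hT₀ (c * p ^ e)) h)
    · exact fun τ hτ τ' hτ' hne =>
        ((Ideal.isCoprime_span_singleton_iff τ τ').2 (hT hτ hτ' hne)).pow
    · rw [hprod, comap_span_singleton_of_retraction, frobeniusPower_sup,
        frobeniusPower_span_singleton, ← map_pow, ← pow_mul]
  · exact Ideal.comap_mono bot_le

open UniqueFactorizationMonoid in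
theorem exists_finset_prime_of_squarefree [IsDomain A] [IsPrincipalIdealRing A] {s : A}
    (hs : Squarefree s) :
    ∃ T : Finset A, (∀ τ ∈ T, Prime τ) ∧ (T : Set A).Pairwise IsCoprime ∧
      Associated (∏ τ ∈ T, τ) s := by
  let _ : StrongNormalizationMonoid A := UniqueFactorizationMonoid.strongNormalizationMonoid
  refine ⟨primeFactors s, fun τ hτ => prime_of_normalized_factor τ (mem_primeFactors.1 hτ), ?_,
    radical_associated hs.isRadical hs.ne_zero⟩
  exact pairwise_primeFactors_isRelPrime.imp fun _ _ => IsRelPrime.isCoprime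

theorem hasLinearGrowthOfPrimaryDecompositions_ker [IsDomain A] [IsPrincipalIdealRing A] {c : ℕ}
    (hc : c ≠ 0)
    (h : ∀ e, ∃ s : A, Squarefree s ∧
      ∀ z ∈ torsionClosure A ((RingHom.ker ε).frobeniusPower (p ^ e)),
        s ^ (c * p ^ e) • z ∈ (RingHom.ker ε).frobeniusPower (p ^ e)) :
    HasLinearGrowthOfPrimaryDecompositions p (RingHom.ker ε) := by
  classical
  refine ⟨c, fun e => ?_⟩
  obtain ⟨s, hs, hsJ⟩ := h e
  obtain ⟨T, hT, hTcop, hTs⟩ := exists_finset_prime_of_squarefree hs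
  have hq : p ^ e ≠ 0 := (expChar_pow_pos R p e).ne'
  have hmax : ∀ τ ∈ T, (Ideal.span {τ}).IsMaximal := fun τ hτ =>
    PrincipalIdealRing.isMaximal_of_irreducible (hT τ hτ).irreducible
  have hTJ : ∀ z ∈ torsionClosure A ((RingHom.ker ε).frobeniusPower (p ^ e)),
      (∏ τ ∈ T, τ) ^ (c * p ^ e) • z ∈ (RingHom.ker ε).frobeniusPower (p ^ e) := fun z hz => by
    obtain ⟨b, hb⟩ := pow_dvd_pow_of_dvd hTs.dvd' (c * p ^ e)
    rw [hb, mul_comm, mul_smul]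
    exact Submodule.smul_of_tower_mem _ b (hsJ z hz)
  refine ⟨insert (torsionClosure A ((RingHom.ker ε).frobeniusPower (p ^ e)))
    (T.image fun τ => ((Ideal.span {τ} ^ c).comap ε).frobeniusPower (p ^ e)),
    ?_, ?_, ?_⟩
  · simp only [Finset.forall_mem_insert, Finset.forall_mem_image]
    refine ⟨isPrimary_torsionClosure_frobeniusPower_ker ε p e, fun τ hτ => ?_⟩
    have := hmax τ hτ
    exact isPrimary_frobeniusPower_comap_pow ε hc hq
  · rw [Finset.inf_insert, Finset.inf_image, Finset.inf_eq_iInf]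
    exact torsionClosure_inf_iInf_frobeniusPower_comap ε p e hTcop
      (mem_nonZeroDivisors_of_ne_zero (Finset.prod_ne_zero_iff.2 fun τ hτ => (hT τ hτ).ne_zero))
      hTJ
  · simp only [Finset.forall_mem_insert, Finset.forall_mem_image]
    refine ⟨?_, fun τ hτ => ?_⟩
    · rw [radical_torsionClosure_frobeniusPower_ker ε hq]
      exact (frobeniusPower_mono (Ideal.pow_le_self hc)).trans le_torsionClosure
    · have := hmax τ hτ
      rw [radical_frobeniusPower_comap_pow ε hc hq]
      exact frobeniusPower_mono (Ideal.le_comap_pow ε c)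

end Criterion

section LinearAlgebra

variable {A ι : Type*} [CommRing A] [DecidableEq ι]

theorem vecMul_adjugate_smul_row_sum [Fintype ι] (M : Matrix ι ι A) (v : ι → A) :
    ∑ i, Matrix.vecMul v M.adjugate i • M.row i = M.det • v := by
  rw [← Matrix.vecMul_one (M.det • v), Matrix.smul_vecMul, ← Matrix.vecMul_smul,
    ← Matrix.adjugate_mul, ← Matrix.vecMul_vecMul, Matrix.vecMul_eq_sum (Matrix.vecMul v _)]
  rfl

variable (K : Type*) [Field K] [Algebra A K] [IsFractionRing A K]

theorem det_smul_mem_span_row_image [Fintype ι] {M : Matrix ι ι A} (hM : LinearIndependent A M.row)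
    {s : Set ι} {v : ι → A}
    (hv : (Algebra.linearMap A K).compLeft ι v ∈
      Submodule.span K ((Algebra.linearMap A K).compLeft ι ∘ M.row '' s)) :
    M.det • v ∈ Submodule.span A (M.row '' s) := by
  set φ := (Algebra.linearMap A K).compLeft ι
  have hφ : Function.Injective φ := (FaithfulSMul.algebraMap_injective A K).comp_left
  have hφM : LinearIndependent K (φ ∘ M.row) :=
    (LinearIndependent.iff_fractionRing A K).1 (hM.map' φ (LinearMap.ker_eq_bot.2 hφ))
  rw [← vecMul_adjugate_smul_row_sum]
  refine Submodule.sum_mem _ fun i _ => ?_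
  by_cases hi : i ∈ s
  · exact Submodule.smul_mem _ _ (Submodule.subset_span (Set.mem_image_of_mem _ hi))
  suffices Matrix.vecMul v M.adjugate i = 0 by simp [this]
  have hsum : ∑ i, algebraMap A K (Matrix.vecMul v M.adjugate i) • φ (M.row i) =
      algebraMap A K M.det • φ v := by
    simp only [algebraMap_smul, ← map_smul, ← map_sum, vecMul_adjugate_smul_row_sum]
  refine FaithfulSMul.algebraMap_injective A K ?_
  rw [map_zero]
  refine hφM.eq_zero_of_smul_mem_span i _ ?_
  rw [← Finset.add_sum_erase _ _ (Finset.mem_univ i), ← eq_sub_iff_add_eq] at hsum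
  rw [Function.comp_apply, hsum]
  refine sub_mem (Submodule.smul_mem _ _ (Submodule.span_mono (Set.image_mono ?_) hv))
    (Submodule.sum_mem _ fun j hj => Submodule.smul_mem _ _ (Submodule.subset_span ⟨j, ?_, rfl⟩))
  · exact fun j hj => ⟨trivial, fun h => hi (h ▸ hj)⟩
  · exact ⟨trivial, Finset.ne_of_mem_erase hj⟩

theorem exists_linearIndependent_row_span [Finite ι] (C : Set (ι → A)) :
    ∃ M : Matrix ι ι A, LinearIndependent A M.row ∧
      (∀ i, M.row i ∈ C ∨ ∃ j, M.row i = Pi.single j 1) ∧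
      (Algebra.linearMap A K).compLeft ι '' C ⊆
        Submodule.span K ((Algebra.linearMap A K).compLeft ι ∘ M.row '' {i | M.row i ∈ C}) := by
  set φ := (Algebra.linearMap A K).compLeft ι
  obtain ⟨b₀, hb₀C, -, hspan₀, hind₀⟩ := exists_linearIndepOn_extension
    (linearIndepOn_empty K φ) (Set.empty_subset C)
  -- Completing by unit vectors keeps the degrees of the entries under control.
  obtain ⟨b, hb, hb₀, hspan, hind⟩ := exists_linearIndepOn_extension hind₀
    (Set.subset_union_left (t := Set.range fun j : ι => Pi.single j (1 : A)))
  have htop : ⊤ ≤ Submodule.span K (Set.range fun w : b => φ w) := by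
    rw [← Set.image_eq_range, ← (Pi.basisFun K ι).span_eq, Submodule.span_le]
    rintro _ ⟨j, rfl⟩
    refine hspan ⟨Pi.single j 1, Or.inr ⟨j, rfl⟩, ?_⟩
    ext l
    simp [φ, Pi.single_apply, apply_ite]
  let σ : b ≃ ι := (Module.Basis.mk hind htop).indexEquiv (Pi.basisFun K ι)
  refine ⟨Matrix.of fun i => (σ.symm i : ι → A), ?_, fun i => ?_, ?_⟩
  · exact LinearIndependent.of_comp φ
      ((LinearIndependent.iff_fractionRing A K).2 (hind.comp _ σ.symm.injective))
  · refine (hb (σ.symm i).2).imp (fun h => hb₀C h) fun ⟨j, hj⟩ => ⟨j, hj.symm⟩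
  · refine hspan₀.trans (Submodule.span_mono ?_)
    rintro _ ⟨w, hw, rfl⟩
    have hσ : Matrix.row (Matrix.of fun i => (σ.symm i : ι → A)) (σ ⟨w, hb₀ hw⟩) = w :=
      congrArg Subtype.val (σ.symm_apply_apply ⟨w, hb₀ hw⟩)
    exact ⟨σ ⟨w, hb₀ hw⟩, Set.mem_ofPred.2 (hσ.symm ▸ hb₀C hw), congrArg φ hσ⟩

theorem exists_det_smul_mem_span [IsDomain A] [Fintype ι] (C : Set (ι → A)) :
    ∃ M : Matrix ι ι A, M.det ≠ 0 ∧ (∀ i, M.row i ∈ C ∨ ∃ j, M.row i = Pi.single j 1) ∧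
      ∀ v, ∀ g ∈ A⁰, g • v ∈ Submodule.span A C → M.det • v ∈ Submodule.span A C := by
  set K := FractionRing A
  set φ := (Algebra.linearMap A K).compLeft ι
  obtain ⟨M, hM, hrow, hC⟩ := exists_linearIndependent_row_span K C
  refine ⟨M, ?_, hrow, fun v g hg hv => ?_⟩
  · exact Matrix.nonsingular_iff_det_ne_zero.1 (Matrix.linearIndependent_row_iff.1 hM)
  · have hφg : algebraMap A K g • φ v ∈ Submodule.span K (φ '' C) := by
      rw [algebraMap_smul, ← map_smul]
      refine Submodule.span_le_restrictScalars A K _ ?_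
      rw [← Submodule.map_span]
      exact Submodule.mem_map_of_mem hv
    have hφ : φ v ∈ Submodule.span K (φ '' C) := by
      refine (Submodule.smul_mem_iff _ ?_).1 hφg
      exact IsFractionRing.to_map_ne_zero_of_mem_nonZeroDivisors hg
    refine Submodule.span_mono ?_
      (det_smul_mem_span_row_image K hM (s := {i | M.row i ∈ C}) (Submodule.span_le.2 hC hφ))
    rintro _ ⟨i, hi, rfl⟩
    exact hi

end LinearAlgebra

section BoundedDegree

open UniqueFactorizationMonoid

variable {k : Type*}

theorem natDegree_det_le {ι : Type*} [Fintype ι] [DecidableEq ι] [CommRing k]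
    {M : Matrix ι ι k[X]} {D : ℕ} (hM : ∀ i j, (M i j).natDegree ≤ D) :
    M.det.natDegree ≤ Fintype.card ι * D := by
  rw [Matrix.det_apply]
  refine natDegree_sum_le_of_forall_le _ _ fun σ _ => (natDegree_smul_le _ _).trans ?_
  exact (natDegree_prod_le _ _).trans (Finset.sum_le_card_nsmul _ _ D fun i _ => hM _ _)

theorem exists_natDegree_le_smul_mem_span {ι : Type*} [Fintype ι] [Field k] {C : Set (ι → k[X])}
    {D : ℕ} (hC : ∀ v ∈ C, ∀ i, (v i).natDegree ≤ D) :
    ∃ δ : k[X], δ ≠ 0 ∧ δ.natDegree ≤ Fintype.card ι * D ∧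
      ∀ v, ∀ g ∈ k[X]⁰, g • v ∈ Submodule.span k[X] C → δ • v ∈ Submodule.span k[X] C := by
  classical
  obtain ⟨M, hdet, hrow, hspan⟩ := exists_det_smul_mem_span C
  refine ⟨M.det, hdet, natDegree_det_le fun i j => ?_, hspan⟩
  obtain h | ⟨l, h⟩ := hrow i
  · exact hC _ h j
  · have hij : M i j = Pi.single (M := fun _ => k[X]) l 1 j := congrFun h j
    rw [hij, Pi.single_apply]
    split_ifs <;> simp

theorem dvd_radical_pow_natDegree [Field k] [NormalizationMonoid k[X]] {a : k[X]} (ha : a ≠ 0) :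
    a ∣ radical a ^ a.natDegree := by
  induction a using WfDvdMonoid.induction_on_irreducible with
  | zero => exact absurd rfl ha
  | unit u hu => exact hu.dvd
  | mul a τ ha₀ hτ ih =>
    have hτr : τ ∣ radical (τ * a) ^ τ.natDegree :=
      dvd_pow ((dvd_radical_iff_of_irreducible hτ ha).2 (dvd_mul_right τ a)) hτ.natDegree_pos.ne'
    have har : a ∣ radical (τ * a) ^ a.natDegree :=
      (ih ha₀).trans (pow_dvd_pow_of_dvd (radical_dvd_radical (dvd_mul_left a τ) ha) _)
    rw [natDegree_mul hτ.ne_zero ha₀, pow_add]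
    exact mul_dvd_mul hτr har

theorem exists_squarefree_dvd_pow_natDegree [Field k] {b : k[X]} (hb : b ≠ 0) :
    ∃ s : k[X], Squarefree s ∧ ∀ a, a ∣ b → a ∣ s ^ a.natDegree := by
  classical
  refine ⟨radical b, squarefree_radical, fun a ha => ?_⟩
  exact (dvd_radical_pow_natDegree (ne_zero_of_dvd_ne_zero hb ha)).trans
    (pow_dvd_pow_of_dvd (radical_dvd_radical ha hb) _)

end BoundedDegree

section BoxExponents

variable {σ M : Type*} [AddCommMonoid M] (w : σ → M) (q : ℕ) (d : M)

/-- The exponents of the monomials of weighted degree `d` that are not divisible by the `q`-th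
power of any variable. -/
def boxExponents : Set (σ →₀ ℕ) :=
  {m | (∀ i, m i < q) ∧ Finsupp.weight w m = d}

theorem finite_setOf_forall_apply_lt [Finite σ] : {m : σ →₀ ℕ | ∀ i, m i < q}.Finite :=
  (Set.Finite.pi' fun _ : σ => Set.finite_Iio q).preimage DFunLike.coe_injective.injOn

theorem boxExponents_finite [Finite σ] : (boxExponents w q d).Finite :=
  (finite_setOf_forall_apply_lt q).subset fun _ hm => hm.1

variable (A : Type*) [CommRing A]

/-- The vector of those coefficients of a polynomial that belong to monomials of weighted degree
`d` not divisible by the `q`-th power of any variable. -/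
noncomputable def boxCoeff : MvPolynomial σ A →ₗ[A] (boxExponents w q d → A) :=
  LinearMap.pi fun m => MvPolynomial.lcoeff A m.1

variable (σ) in
/-- The ideal generated by the `q`-th powers of the variables. -/
noncomputable def idealOfVarPowers : Ideal (MvPolynomial σ A) :=
  Ideal.span (Set.range fun i => MvPolynomial.X i ^ q)

variable {A w q d} {f : MvPolynomial σ A} {𝔞 : Ideal (MvPolynomial σ A)}

theorem mem_idealOfVarPowers_iff :
    f ∈ idealOfVarPowers σ q A ↔ ∀ m, (∀ i, m i < q) → MvPolynomial.coeff m f = 0 := by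
  have hrange : (Set.range fun i : σ => (MvPolynomial.X i : MvPolynomial σ A) ^ q) =
      (fun m => MvPolynomial.monomial m (1 : A)) '' Set.range fun i => Finsupp.single i q := by
    simp only [← Set.range_comp, Function.comp_def, MvPolynomial.X_pow_eq_monomial]
  rw [idealOfVarPowers, hrange, MvPolynomial.mem_ideal_span_monomial_image]
  simp only [MvPolynomial.mem_support_iff, Set.exists_range_iff, Finsupp.single_le_iff]
  refine forall_congr' fun m => ?_
  rw [← not_imp_not]
  simp only [not_exists, not_le, not_not]

theorem boxCoeff_eq_zero_iff :
    boxCoeff w q d A f = 0 ↔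
      MvPolynomial.weightedHomogeneousComponent w d f ∈ idealOfVarPowers σ q A := by
  classical
  simp only [mem_idealOfVarPowers_iff, MvPolynomial.coeff_weightedHomogeneousComponent,
    ite_eq_right_iff]
  exact ⟨fun h m hm hd => congrFun h ⟨m, hm, hd⟩, fun h => funext fun m => h m.1 m.2.1 m.2.2⟩

theorem boxCoeff_mem_map (hf : f ∈ idealOfVarPowers σ q A ⊔ 𝔞) :
    boxCoeff w q d A f ∈ (𝔞.restrictScalars A).map (boxCoeff w q d A) := by
  obtain ⟨a, ha, h, hh, rfl⟩ := Submodule.mem_sup.1 hf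
  have ha₀ : boxCoeff w q d A a = 0 := funext fun m => mem_idealOfVarPowers_iff.1 ha m.1 m.2.1
  rw [map_add, ha₀, zero_add]
  exact Submodule.mem_map_of_mem hh

attribute [local instance] MvPolynomial.weightedGradedAlgebra in
theorem weightedHomogeneousComponent_mem_of_boxCoeff_mem [DecidableEq M]
    (h𝔞 : 𝔞.IsHomogeneous (MvPolynomial.weightedHomogeneousSubmodule A w))
    (hf : boxCoeff w q d A f ∈ (𝔞.restrictScalars A).map (boxCoeff w q d A)) :
    MvPolynomial.weightedHomogeneousComponent w d f ∈ idealOfVarPowers σ q A ⊔ 𝔞 := by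
  obtain ⟨h, hh, hfh⟩ := hf
  rw [← sub_add_cancel f h, map_add]
  refine Submodule.add_mem_sup (boxCoeff_eq_zero_iff.1 ?_)
    (MvPolynomial.weightedHomogeneousComponent_mem_of_mem A w h𝔞 hh d)
  rw [map_sub, hfh, sub_self]

end BoxExponents

section Torsion

variable {k σ M : Type*}

theorem exists_span_natDegree_coeff_le_eq [CommSemiring k] {𝔞 : Ideal (MvPolynomial σ k[X])}
    (h𝔞 : 𝔞.FG) :
    ∃ D : ℕ, Submodule.span k[X] {h ∈ 𝔞 | ∀ m, (MvPolynomial.coeff m h).natDegree ≤ D} =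
      𝔞.restrictScalars k[X] := by
  classical
  obtain ⟨S, rfl⟩ := h𝔞
  let D (h : MvPolynomial σ k[X]) : ℕ :=
    h.support.sup fun m => (MvPolynomial.coeff m h).natDegree
  have hD (h : MvPolynomial σ k[X]) (m : σ →₀ ℕ) : (MvPolynomial.coeff m h).natDegree ≤ D h := by
    by_cases hm : MvPolynomial.coeff m h = 0
    · simp [hm]
    · exact Finset.le_sup (f := fun m => (MvPolynomial.coeff m h).natDegree)
        (MvPolynomial.mem_support_iff.2 hm)
  refine ⟨S.sup D, le_antisymm (Submodule.span_le.2 fun h hh => hh.1) ?_⟩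
  rw [Ideal.span, ← Submodule.span_smul_of_span_eq_top
    (MvPolynomial.basisMonomials σ k[X]).span_eq]
  refine Submodule.span_mono ?_
  rintro _ ⟨_, ⟨n, rfl⟩, h, hh, rfl⟩
  refine ⟨Ideal.mul_mem_left _ _ (Ideal.subset_span hh), fun m => ?_⟩
  simp only [MvPolynomial.coe_basisMonomials, smul_eq_mul, MvPolynomial.coeff_monomial_mul',
    one_mul]
  split_ifs
  · exact (hD h _).trans (Finset.le_sup hh)
  · exact natDegree_zero.trans_le (Nat.zero_le _)

variable [AddCommMonoid M] [DecidableEq M] {w : σ → M} {q D : ℕ}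
  [Field k] [Finite σ] {𝔞 : Ideal (MvPolynomial σ k[X])}

attribute [local instance] MvPolynomial.weightedGradedAlgebra

theorem exists_natDegree_le_smul_weightedHomogeneousComponent_mem
    (h𝔞 : 𝔞.IsHomogeneous (MvPolynomial.weightedHomogeneousSubmodule k[X] w))
    (hD : Submodule.span k[X] {h ∈ 𝔞 | ∀ m, (MvPolynomial.coeff m h).natDegree ≤ D} =
      𝔞.restrictScalars k[X]) (q : ℕ) (d : M) :
    ∃ δ : k[X], δ ≠ 0 ∧ δ.natDegree ≤ (boxExponents w q d).ncard * D ∧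
      ∀ f ∈ torsionClosure k[X] (idealOfVarPowers σ q k[X] ⊔ 𝔞),
        δ • MvPolynomial.weightedHomogeneousComponent w d f ∈ idealOfVarPowers σ q k[X] ⊔ 𝔞 := by
  have := (boxExponents_finite w q d).fintype
  set φ := boxCoeff w q d k[X]
  obtain ⟨δ, hδ, hδD, hδφ⟩ := exists_natDegree_le_smul_mem_span (D := D)
    (C := φ '' {h ∈ 𝔞 | ∀ m, (MvPolynomial.coeff m h).natDegree ≤ D})
    (by rintro _ ⟨h, ⟨-, hh⟩, rfl⟩ m; exact hh m.1)
  rw [← Submodule.map_span, hD] at hδφ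
  refine ⟨δ, hδ, hδD.trans_eq ?_, fun f ⟨g, hg, hf⟩ => ?_⟩
  · rw [← Nat.card_coe_set_eq, Nat.card_eq_fintype_card]
  · rw [← map_smul]
    refine weightedHomogeneousComponent_mem_of_boxCoeff_mem h𝔞 ?_
    rw [map_smul]
    exact hδφ _ g hg (map_smul φ g f ▸ boxCoeff_mem_map hf)

theorem exists_squarefree_pow_smul_mem
    (h𝔞 : 𝔞.IsHomogeneous (MvPolynomial.weightedHomogeneousSubmodule k[X] w))
    (hD : Submodule.span k[X] {h ∈ 𝔞 | ∀ m, (MvPolynomial.coeff m h).natDegree ≤ D} =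
      𝔞.restrictScalars k[X]) {N : ℕ} (hN : ∀ d, (boxExponents w q d).ncard * D ≤ N) :
    ∃ s : k[X], Squarefree s ∧ ∀ f ∈ torsionClosure k[X] (idealOfVarPowers σ q k[X] ⊔ 𝔞),
      s ^ N • f ∈ idealOfVarPowers σ q k[X] ⊔ 𝔞 := by
  choose δ hδ hδD hδf using exists_natDegree_le_smul_weightedHomogeneousComponent_mem h𝔞 hD q
  let W := (finite_setOf_forall_apply_lt (σ := σ) q).toFinset.image (Finsupp.weight w)
  obtain ⟨s, hs, hδs⟩ :=
    exists_squarefree_dvd_pow_natDegree (Finset.prod_ne_zero_iff.2 fun d (_ : d ∈ W) => hδ d)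
  refine ⟨s, hs, fun f hf => ?_⟩
  rw [← MvPolynomial.sum_weightedHomogeneousComponent w f, finsum_eq_sum _
    (MvPolynomial.weightedHomogeneousComponent_finsupp f), Finset.smul_sum]
  refine Submodule.sum_mem _ fun d _ => ?_
  by_cases hd : d ∈ W
  · obtain ⟨a, ha⟩ := (hδs (δ d) (Finset.dvd_prod_of_mem δ hd)).trans
      (pow_dvd_pow s ((hδD d).trans (hN d)))
    rw [ha, mul_comm, mul_smul]
    exact Submodule.smul_of_tower_mem _ a (hδf d f hf)
  · refine Submodule.smul_of_tower_mem _ _ (Ideal.mem_sup_left (boxCoeff_eq_zero_iff.1 ?_))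
    exact funext fun m => (hd (Finset.mem_image.2 ⟨m.1, by simpa using m.2.1, m.2.2⟩)).elim

end Torsion

section GradedQuotient

variable {σ : Type*}

theorem ker_aeval_zero {A : Type*} [CommRing A] :
    RingHom.ker (MvPolynomial.aeval fun _ : σ => (0 : A)) = MvPolynomial.idealOfVars σ A := by
  ext f
  rw [← pow_one (MvPolynomial.idealOfVars σ A), MvPolynomial.mem_pow_idealOfVars_iff']
  simp [MvPolynomial.aeval_zero', MvPolynomial.constantCoeff_eq, Finsupp.degree_eq_zero_iff]

theorem exists_retraction_ker_eq {A : Type*} [CommRing A] {𝔞 : Ideal (MvPolynomial σ A)}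
    (h𝔞 : 𝔞 ≤ MvPolynomial.idealOfVars σ A) :
    ∃ ε : (MvPolynomial σ A ⧸ 𝔞) →ₐ[A] A,
      RingHom.ker ε = (MvPolynomial.idealOfVars σ A).map (Ideal.Quotient.mk 𝔞) := by
  have h := ker_aeval_zero.ge.trans' h𝔞
  refine ⟨Ideal.Quotient.liftₐ 𝔞 (MvPolynomial.aeval fun _ => 0) h, ?_⟩
  rw [← ker_aeval_zero]
  exact Ideal.ker_quotient_lift _ h

theorem mk_mem_frobeniusPower_map_idealOfVars_iff {A : Type*} [CommRing A]
    {𝔞 : Ideal (MvPolynomial σ A)} {p : ℕ} [Fact p.Prime] [CharP (MvPolynomial σ A ⧸ 𝔞) p] {e : ℕ}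
    {f : MvPolynomial σ A} :
    Ideal.Quotient.mk 𝔞 f ∈
        ((MvPolynomial.idealOfVars σ A).map (Ideal.Quotient.mk 𝔞)).frobeniusPower (p ^ e) ↔
      f ∈ idealOfVarPowers σ (p ^ e) A ⊔ 𝔞 := by
  have h : ((MvPolynomial.idealOfVars σ A).map (Ideal.Quotient.mk 𝔞)).frobeniusPower (p ^ e) =
      (idealOfVarPowers σ (p ^ e) A).map (Ideal.Quotient.mk 𝔞) := by
    rw [Ideal.map_span, Ideal.frobeniusPower_span, idealOfVarPowers, Ideal.map_span]
    simp only [← Set.range_comp, Function.comp_def, map_pow]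
  rw [h, ← Ideal.mem_comap, Ideal.comap_map_of_surjective _ Ideal.Quotient.mk_surjective,
    ← RingHom.ker_eq_comap_bot, Ideal.mk_ker]

attribute [local instance] MvPolynomial.weightedGradedAlgebra in
theorem hasLinearGrowthOfPrimaryDecompositions_map_idealOfVars {k M : Type*} [Field k] [Finite σ]
    [AddCommMonoid M] [DecidableEq M] {w : σ → M} (p : ℕ) [Fact p.Prime] [CharP k p]
    {𝔞 : Ideal (MvPolynomial σ k[X])}
    (h𝔞 : 𝔞.IsHomogeneous (MvPolynomial.weightedHomogeneousSubmodule k[X] w))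
    (h𝔞X : 𝔞 ≤ MvPolynomial.idealOfVars σ k[X]) {C : ℕ}
    (hC : ∀ q d, (boxExponents w q d).ncard ≤ C * q) :
    HasLinearGrowthOfPrimaryDecompositions p
      ((MvPolynomial.idealOfVars σ k[X]).map (Ideal.Quotient.mk 𝔞)) := by
  obtain ⟨ε, hε⟩ := exists_retraction_ker_eq h𝔞X
  have : CharP (MvPolynomial σ k[X] ⧸ 𝔞) p :=
    charP_of_injective_ringHom (f := algebraMap k[X] _)
      (Function.LeftInverse.injective (g := ε) ε.commutes) p
  obtain ⟨D, hD⟩ := exists_span_natDegree_coeff_le_eq (IsNoetherian.noetherian 𝔞)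
  rw [← hε]
  refine hasLinearGrowthOfPrimaryDecompositions_ker ε p (c := C * D + 1) (Nat.succ_ne_zero _)
    fun e => ?_
  have hN (d : M) : (boxExponents w (p ^ e) d).ncard * D ≤ (C * D + 1) * p ^ e :=
    (Nat.mul_le_mul_right D (hC (p ^ e) d)).trans <| by
      rw [mul_right_comm, add_one_mul]
      exact Nat.le_add_right _ _
  obtain ⟨s, hs, hsf⟩ := exists_squarefree_pow_smul_mem h𝔞 hD hN
  refine ⟨s, hs, fun z ⟨g, hg, hgz⟩ => ?_⟩
  obtain ⟨f, rfl⟩ := Ideal.Quotient.mk_surjective z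
  rw [hε] at hgz ⊢
  exact mk_mem_frobeniusPower_map_idealOfVars_iff.2
    (hsf f ⟨g, hg, mk_mem_frobeniusPower_map_idealOfVars_iff.1 hgz⟩)

end GradedQuotient

namespace SSHypersurface

/-- The degrees of `u, v, x, y` in the `ℤ³`-grading for which `r₀u²x² + r₁uxvy + r₂v²y²` is
homogeneous over `k[t]`: the degree in `u` minus the degree in `x`, the degree in `v` minus the
degree in `y`, and the total degree in `u` and `v`. -/
def multidegree : Fin 4 → ℤ × ℤ × ℤ :=
  ![(1, 0, 1), (0, 1, 1), (-1, 0, 0), (0, -1, 0)]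

theorem weight_multidegree (m : Fin 4 →₀ ℕ) :
    Finsupp.weight multidegree m = ((m 0 : ℤ) - m 2, (m 1 : ℤ) - m 3, (m 0 : ℤ) + m 1) := by
  rw [Finsupp.weight_apply, Finsupp.sum_fintype _ _ (by simp), Fin.sum_univ_four]
  simp [multidegree, sub_eq_add_neg]

theorem ncard_boxExponents_multidegree_le (q : ℕ) (d : ℤ × ℤ × ℤ) :
    (boxExponents multidegree q d).ncard ≤ q := by
  rw [← Nat.card_Iio q, ← Set.ncard_coe_finset]
  refine Set.ncard_le_ncard_of_injOn (fun m => m 0) (fun m hm => by simpa using hm.1 0) ?_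
    (Finset.finite_toSet _)
  rintro m ⟨-, hm⟩ n ⟨-, hn⟩ (h₀ : m 0 = n 0)
  rw [← hn, weight_multidegree, weight_multidegree] at hm
  simp only [Prod.mk.injEq] at hm
  ext i
  fin_cases i <;> simp only [Fin.mk_one, Fin.zero_eta, Fin.reduceFinMk] <;> omega

variable {k : Type*} [Field k] (r₀ r₁ r₂ : k[X])

theorem isWeightedHomogeneous_equation :
    (equation r₀ r₁ r₂).IsWeightedHomogeneous multidegree (0, 0, 2) := by
  have hC (r : k[X]) : (MvPolynomial.C r : PolyRing k).IsWeightedHomogeneous multidegree 0 :=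
    MvPolynomial.isWeightedHomogeneous_C _ r
  have hX (i : Fin 4) : (MvPolynomial.X i : PolyRing k).IsWeightedHomogeneous multidegree
      (multidegree i) := MvPolynomial.isWeightedHomogeneous_X _ _ i
  have h₀ := ((hC r₀).mul ((hX 0).pow 2)).mul ((hX 2).pow 2)
  have h₁ := ((((hC r₁).mul (hX 0)).mul (hX 2)).mul (hX 1)).mul (hX 3)
  have h₂ := ((hC r₂).mul ((hX 1).pow 2)).mul ((hX 3).pow 2)
  refine MvPolynomial.IsWeightedHomogeneous.add (MvPolynomial.IsWeightedHomogeneous.add ?_ ?_) ?_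
  · simpa [multidegree] using h₀
  · simpa [multidegree] using h₁
  · simpa [multidegree] using h₂

attribute [local instance] MvPolynomial.weightedGradedAlgebra in
theorem isHomogeneous_span_equation :
    (Ideal.span {equation r₀ r₁ r₂}).IsHomogeneous
      (MvPolynomial.weightedHomogeneousSubmodule k[X] multidegree) :=
  Ideal.homogeneous_span _ _ fun _ h => ⟨_, h ▸ isWeightedHomogeneous_equation r₀ r₁ r₂⟩

theorem equation_mem_idealOfVars :
    equation r₀ r₁ r₂ ∈ MvPolynomial.idealOfVars (Fin 4) k[X] := by
  rw [← ker_aeval_zero, RingHom.mem_ker]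
  simp [equation]

theorem idealUVXY_eq_map :
    idealUVXY r₀ r₁ r₂ = (MvPolynomial.idealOfVars (Fin 4) k[X]).map
      (Ideal.Quotient.mk (Ideal.span {equation r₀ r₁ r₂})) := by
  rw [Ideal.map_span, ← Set.range_comp]
  rfl

end SSHypersurface

open SSHypersurface in
theorem mainTheorem1_general {k : Type*} [Field k] (p : ℕ) [Fact p.Prime] [CharP k p]
    (r₀ r₁ r₂ : k[X]) :
    HasLinearGrowthOfPrimaryDecompositions (R := CoordRing r₀ r₁ r₂) p (idealUVXY r₀ r₁ r₂) := by
  have hvars : Ideal.span {equation r₀ r₁ r₂} ≤ MvPolynomial.idealOfVars (Fin 4) k[X] :=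
    (Ideal.span_singleton_le_iff_mem _).2 (equation_mem_idealOfVars r₀ r₁ r₂)
  rw [idealUVXY_eq_map]
  exact hasLinearGrowthOfPrimaryDecompositions_map_idealOfVars p
    (isHomogeneous_span_equation r₀ r₁ r₂) hvars (C := 1) fun q d =>
      (ncard_boxExponents_multidegree_le q d).trans_eq (one_mul q).symm

theorem mainTheorem1 {k : Type*} [Field k] (p : ℕ) [Fact p.Prime] [CharP k p] :
    (∀ r₀ r₁ r₂ : k[X], r₀ * r₂ ≠ 0 →
      r₀.natDegree + r₂.natDegree < 2 * r₁.natDegree →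
      HasLinearGrowthOfPrimaryDecompositions (R := SSHypersurface.CoordRing r₀ r₁ r₂) p
        (SSHypersurface.idealUVXY r₀ r₁ r₂)) ∧
    HasLinearGrowthOfPrimaryDecompositions
      (R := SSHypersurface.CoordRing (1 : k[X]) (X : k[X]) (1 : k[X])) p
      (SSHypersurface.idealUVXY (1 : k[X]) (X : k[X]) (1 : k[X])) :=
  ⟨fun r₀ r₁ r₂ _ _ => mainTheorem1_general p r₀ r₁ r₂, mainTheorem1_general p 1 X 1⟩
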